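/- All graphs are simple, undirected, and finite or countably infinite. Let $\mathbb{C}_3$ be the generic circular triangle-free graph: its vertices are the complex numbers $z$ with $|z|=1$ and $\arg z\in\mathbb{Q}$, and two vertices $z,w$ are adjacent if and only if $|\arg(z/w)|>\frac{2}{3}\pi$, where $\arg$ takes values in $(-\pi,\pi]$. A graph $H$ is called anti-even-signable if there is a labelling $\sigma\colon E(H)\to\mathbb{Z}_2$ such that for every induced cycle $C$ of $H$ (a finite cycle of length at least $3$ that is an induced subgraph of $H$) one has $\sum_{e\in E(C)}\sigma(e)=0$ if $C$ is a triangle, and $\sum_{e\in E(C)}\sigma(e)=1$ otherwise. \textbf{Theorem.} Let $G$ be a triangle-free graph. Then $G$ is isomorphic to an induced subgraph of $\mathbb{C}_3$ if and only if the complement $\overline{G}$ of $G$ is anti-even-signable. -/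

import Mathlib

open SimpleGraph

noncomputable section

namespace CircularTriangleFree

/-- The vertices of the generic circular triangle-free graph: the unit complex numbers whose
argument, a real number in the interval from `-π` (excluded) to `π` (included), is rational. -/
def Vertex : Type := {z : ℂ // ‖z‖ = 1 ∧ ∃ q : ℚ, z.arg = (q : ℝ)}

/-- The generic circular triangle-free graph: `z` and `w` are adjacent if and only if
`|arg (z / w)| > 2π/3`. -/
def genericGraph : SimpleGraph Vertex where
  Adj z w := 2 / 3 * Real.pi < |(z.1 / w.1).arg|
  symm := ⟨fun z w h => by
    rw [← Complex.abs_arg_inv, inv_div] at h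
    exact h⟩
  loopless := ⟨fun z h => by
    have hz : z.1 ≠ 0 := by
      intro h0
      have h1 := z.2.1
      rw [h0, norm_zero] at h1
      exact zero_ne_one h1
    rw [div_self hz, Complex.arg_one, abs_zero] at h
    linarith [Real.pi_pos]⟩

variable {V : Type*} (G : SimpleGraph V)

/-- A labelling of `G` assigns an element of `ℤ/2ℤ` to every edge of `G`. -/
abbrev Labelling : Type _ := G.edgeSet → ZMod 2

/-- The induced cycles of `G`: the induced subgraphs of `G` that are (finite) cycles. -/
def inducedCycles : Set G.Subgraph :=
  {H | H.IsInduced ∧ ∃ n : ℕ, 3 ≤ n ∧ Nonempty (H.coe ≃g cycleGraph n)}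

variable {G}

/-- The sum of the labels of the edges of a (finite) subgraph `H` of `G`. -/
def Labelling.sum (σ : Labelling G) (H : G.Subgraph) : ZMod 2 :=
  ∑ᶠ e : H.edgeSet, σ ⟨e.1, H.edgeSet_subset e.2⟩

/-- The labelling `σ` is `β`-balancing: its sum over every induced cycle `C` is `β C`. -/
def IsBalancing (β : inducedCycles G → ZMod 2) (σ : Labelling G) : Prop :=
  ∀ C : inducedCycles G, σ.sum C.1 = β C

/-- The graph `G` is `β`-balanceable if it has a `β`-balancing labelling. -/
def IsBalanceable (β : inducedCycles G → ZMod 2) : Prop :=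
  ∃ σ : Labelling G, IsBalancing β σ

open scoped Classical in
/-- The prescribed sums: `0` for triangles and `1` for all other induced cycles. -/
def antiEven (G : SimpleGraph V) (C : inducedCycles G) : ZMod 2 :=
  if C.1.verts.ncard = 3 then 0 else 1

/-- `G` is anti-even-signable: there is a labelling in which every induced triangle has sum `0`
and every other induced cycle has sum `1`. -/
def AntiEvenSignable (G : SimpleGraph V) : Prop :=
  IsBalanceable (antiEven G)

end CircularTriangleFree

end

open SimpleGraph

noncomputable section

namespace CircularTriangleFree

variable {V : Type*}

/-! ### Induced cycles and cyclic label sums -/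

section Cycles

variable {H : SimpleGraph V}

/-! In terms of angles, adjacency in `genericGraph` means differing by more than 2π/3 modulo 2π.
Distinct nonadjacent vertices differ by strictly less, as π is irrational.

Given an embedding, label each nonadjacent pair by the parity of the `turn` needed to bring its
angle difference into [-π, π]. On an induced cycle of the complement the label sum is the parity of
the winding number K. Triangle-freeness bounds the length by 5, so the short steps force |K| ≤ 1,
and K = 0 on triangles. If K = 0, the cycle lifts to the line, where the two neighbours of a minimum
are close; so they are nonadjacent in G and the cycle is a triangle (`antiEvenSignable_of_angles`).

Conversely, a labelling, used only on cycles of length 3, 4 and 5, is switched to vanish inside N(v)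
and inside its complement. N(v) becomes one colour class, and the labels between the two sides split
the rest into two more (`exists_isCircularColouring`). The colouring orients bichromatic pairs, and
its axioms make this orientation extend to a linear order
(`IsCircularColouring.exists_linearOrder`). The colour then picks one of three arcs of length 2π/3
and the order gives the position in it (`exists_rational_angles`). -/

theorem add_one_cancel_two {n : ℕ} {i j : Fin (n + 3)} (h₁ : i = j + 1) (h₂ : i + 1 = j) :
    False := by
  rw [h₁, add_assoc, add_eq_left] at h₂
  have := congrArg Fin.val h₂
  rw [Fin.val_add, Fin.val_one, Fin.val_zero, Nat.mod_eq_of_lt (by omega)] at this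
  omega

/-- The sum of a labelling over a cycle, along a cyclic enumeration of the vertices. -/
theorem Labelling.sum_eq (σ : Labelling H) (g : Sym2 V → ZMod 2) (hg : ∀ e, σ e = g e.1)
    (C : H.Subgraph) {n : ℕ} (e : C.coe ≃g cycleGraph (n + 3)) :
    σ.sum C = ∑ i, g s((e.symm i).1, (e.symm (i + 1)).1) := by
  have hadj (i : Fin (n + 3)) : C.Adj (e.symm i).1 (e.symm (i + 1)).1 := by
    have : C.coe.Adj (e.symm i) (e.symm (i + 1)) := by
      rw [e.symm.map_adj_iff, cycleGraph_adj]
      right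
      simp
    exact this
  -- Length at least 3 makes `F` injective: no edge is met again in reverse.
  let F : Fin (n + 3) → C.edgeSet := fun i => ⟨s((e.symm i).1, (e.symm (i + 1)).1), hadj i⟩
  have hF : Function.Bijective F := by
    refine ⟨fun i j hij => ?_, ?_⟩
    · have h := congrArg Subtype.val hij
      simp only [F, Sym2.eq_iff, Subtype.val_inj, EmbeddingLike.apply_eq_iff_eq] at h
      rcases h with h | h
      · exact h.1
      · exact (add_one_cancel_two h.1 h.2).elim
    · rintro ⟨p, hp⟩
      induction p using Sym2.ind with
      | _ u v =>
        have huv : C.Adj u v := hp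
        have h : C.coe.Adj ⟨u, huv.fst_mem⟩ ⟨v, huv.snd_mem⟩ := huv
        rw [← e.map_adj_iff, cycleGraph_adj] at h
        rcases h with h | h
        · refine ⟨e ⟨v, huv.snd_mem⟩, Subtype.ext ?_⟩
          have h' : e ⟨v, huv.snd_mem⟩ + 1 = e ⟨u, huv.fst_mem⟩ := by rw [← h]; abel
          simp only [F, h', RelIso.symm_apply_apply]
          exact Sym2.eq_swap
        · refine ⟨e ⟨u, huv.fst_mem⟩, Subtype.ext ?_⟩
          have h' : e ⟨u, huv.fst_mem⟩ + 1 = e ⟨v, huv.snd_mem⟩ := by rw [← h]; abel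
          simp only [F, h', RelIso.symm_apply_apply]
  unfold Labelling.sum
  rw [← finsum_eq_of_bijective F hF (fun i => rfl), finsum_eq_sum_of_fintype]
  exact Finset.sum_congr rfl fun i _ => hg _

/-- The subgraph induced on the image of an embedded cycle is a cycle. -/
def inducedCycleIso {n : ℕ} (f : cycleGraph n ↪g H) :
    ((⊤ : H.Subgraph).induce (Set.range f)).coe ≃g cycleGraph n :=
  RelIso.symm
    { toEquiv := Equiv.ofInjective f f.injective
      map_rel_iff' := by
        intro a b
        change (_ ∈ Set.range f ∧ _ ∈ Set.range f ∧ H.Adj (f a) (f b)) ↔ _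
        rw [f.map_adj_iff]
        exact ⟨fun h => h.2.2, fun h => ⟨⟨a, rfl⟩, ⟨b, rfl⟩, h⟩⟩ }

theorem inducedCycle_mem {n : ℕ} (f : cycleGraph (n + 3) ↪g H) :
    (⊤ : H.Subgraph).induce (Set.range f) ∈ inducedCycles H :=
  ⟨fun _ hv _ hw h => ⟨hv, hw, h⟩, n + 3, by omega, ⟨inducedCycleIso f⟩⟩

theorem ncard_verts_of_iso {n : ℕ} {C : H.Subgraph} (e : C.coe ≃g cycleGraph n) :
    C.verts.ncard = n := by
  have h := Nat.card_congr e.toEquiv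
  rwa [Nat.card_fin] at h

/-- Anti-even-signability in terms of embedded cycles. -/
theorem antiEvenSignable_iff :
    AntiEvenSignable H ↔ ∃ g : Sym2 V → ZMod 2, ∀ (n : ℕ) (f : cycleGraph (n + 3) ↪g H),
      ∑ i, g s(f i, f (i + 1)) = if n = 0 then 0 else 1 := by
  classical
  constructor
  · rintro ⟨σ, hσ⟩
    refine ⟨fun e => if h : e ∈ H.edgeSet then σ ⟨e, h⟩ else 0, fun n f => ?_⟩
    have h := hσ ⟨_, inducedCycle_mem f⟩
    rw [Labelling.sum_eq σ (fun e => if h : e ∈ H.edgeSet then σ ⟨e, h⟩ else 0)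
      (fun e => by simp) _ (inducedCycleIso f)] at h
    rw [antiEven, ncard_verts_of_iso (inducedCycleIso f)] at h
    simp only [Nat.add_eq_right] at h
    exact h
  · rintro ⟨g, hg⟩
    refine ⟨fun e => g e.1, ?_⟩
    rintro ⟨C, hC, n, hn, ⟨e⟩⟩
    obtain ⟨n, rfl⟩ := Nat.exists_eq_add_of_le' hn
    rw [Labelling.sum_eq _ g (fun e => rfl) C e, antiEven, ncard_verts_of_iso e]
    simp only [Nat.add_eq_right]
    exact hg n
      { toFun := fun i => (e.symm i).1
        inj' := Subtype.val_injective.comp e.symm.injective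
        map_rel_iff' := by
          intro a b
          rw [← e.symm.map_adj_iff]
          exact ⟨fun h => hC (e.symm a).2 (e.symm b).2 h, fun h => C.adj_sub h⟩ }

end Cycles

/-! ### From signings to circular colourings -/

section Colouring

/-- A symmetric labelling of pairs which has sum `0` on the independent triples of `G` and sum `1`
on the induced cycles of length four and five of the complement of `G`. -/
structure IsSigning (G : SimpleGraph V) (s : V → V → ZMod 2) : Prop where
  symm : ∀ a b, s a b = s b a
  triangle : ∀ a b c, Gᶜ.Adj a b → Gᶜ.Adj b c → Gᶜ.Adj c a → s a b + s b c + s c a = 0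
  square : ∀ a b c d, Gᶜ.Adj a b → Gᶜ.Adj b c → Gᶜ.Adj c d → Gᶜ.Adj d a →
    G.Adj a c → G.Adj b d → s a b + s b c + s c d + s d a = 1
  pentagon : ∀ a b c d e, Gᶜ.Adj a b → Gᶜ.Adj b c → Gᶜ.Adj c d → Gᶜ.Adj d e → Gᶜ.Adj e a →
    G.Adj a c → G.Adj b d → G.Adj c e → G.Adj d a → G.Adj e b →
    s a b + s b c + s c d + s d e + s e a = 1

variable {G : SimpleGraph V}

theorem exists_isSigning (h : AntiEvenSignable Gᶜ) : ∃ s, IsSigning G s := by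
  obtain ⟨g, hg⟩ := antiEvenSignable_iff.1 h
  have hsum (n : ℕ) (x : Fin (n + 3) → V) (hx : ∀ i j, i < j →
      x i ≠ x j ∧ (Gᶜ.Adj (x i) (x j) ↔ (cycleGraph (n + 3)).Adj i j)) :
      ∑ i, g s(x i, x (i + 1)) = if n = 0 then 0 else 1 := by
    refine hg n { toFun := x, inj' := fun i j hij => ?_, map_rel_iff' := fun {i j} => ?_ }
    · by_contra hne
      rcases lt_or_gt_of_ne hne with h | h
      · exact (hx i j h).1 hij
      · exact (hx j i h).1 hij.symm
    · rcases lt_trichotomy i j with h | rfl | h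
      · exact (hx i j h).2
      · exact iff_of_false (Gᶜ.irrefl) (cycleGraph (n + 3)).irrefl
      · rw [(cycleGraph (n + 3)).adj_comm]
        exact Gᶜ.adj_comm _ _ |>.trans (hx j i h).2
  have near {u v : V} (h : Gᶜ.Adj u v) {p : Prop} (hp : p) : u ≠ v ∧ (Gᶜ.Adj u v ↔ p) :=
    ⟨h.ne, iff_of_true h hp⟩
  have far {u v : V} (h : G.Adj u v) {p : Prop} (hp : ¬ p) : u ≠ v ∧ (Gᶜ.Adj u v ↔ p) :=
    ⟨h.ne, iff_of_false (fun h' => ((compl_adj _ _ _).1 h').2 h) hp⟩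
  refine ⟨fun a b => g s(a, b), fun a b => by rw [Sym2.eq_swap], ?_, ?_, ?_⟩
  · intro a b c hab hbc hca
    have h := hsum 0 ![a, b, c] (by
      intro i j hij
      fin_cases i <;> fin_cases j <;>
      first
      | exact absurd hij (by decide)
      | exact near hab (by decide)
      | exact near hbc (by decide)
      | exact near hca.symm (by decide))
    simpa [Fin.sum_univ_succ, add_assoc] using h
  · intro a b c d hab hbc hcd hda hac hbd
    have h := hsum 1 ![a, b, c, d] (by
      intro i j hij
      fin_cases i <;> fin_cases j <;>
      first
      | exact absurd hij (by decide)
      | exact near hab (by decide)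
      | exact near hbc (by decide)
      | exact near hcd (by decide)
      | exact near hda.symm (by decide)
      | exact far hac (by decide)
      | exact far hbd (by decide))
    simpa [Fin.sum_univ_succ, add_assoc] using h
  · intro a b c d e hab hbc hcd hde hea hac hbd hce hda heb
    have h := hsum 2 ![a, b, c, d, e] (by
      intro i j hij
      fin_cases i <;> fin_cases j <;>
      first
      | exact absurd hij (by decide)
      | exact near hab (by decide)
      | exact near hbc (by decide)
      | exact near hcd (by decide)
      | exact near hde (by decide)
      | exact near hea.symm (by decide)
      | exact far hac (by decide)
      | exact far hbd (by decide)
      | exact far hce (by decide)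
      | exact far hda.symm (by decide)
      | exact far heb.symm (by decide))
    simpa [Fin.sum_univ_succ, add_assoc] using h

/-- Switching a signing. -/
theorem IsSigning.switch {s : V → V → ZMod 2} (hs : IsSigning G s) (p : V → ZMod 2) :
    IsSigning G fun a b => s a b + p a + p b := by
  have h2 (x : ZMod 2) : x + x = 0 := CharTwo.add_self_eq_zero x
  refine ⟨fun a b => by rw [hs.symm]; abel, ?_, ?_, ?_⟩
  · intro a b c h₁ h₂ h₃
    linear_combination hs.triangle a b c h₁ h₂ h₃ + h2 (p a) + h2 (p b) + h2 (p c)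
  · intro a b c d h₁ h₂ h₃ h₄ h₅ h₆
    linear_combination hs.square a b c d h₁ h₂ h₃ h₄ h₅ h₆ +
      h2 (p a) + h2 (p b) + h2 (p c) + h2 (p d)
  · intro a b c d e h₁ h₂ h₃ h₄ h₅ h₆ h₇ h₈ h₉ h₁₀
    linear_combination hs.pentagon a b c d e h₁ h₂ h₃ h₄ h₅ h₆ h₇ h₈ h₉ h₁₀ +
      h2 (p a) + h2 (p b) + h2 (p c) + h2 (p d) + h2 (p e)

/-- In a triangle-free graph, a signing can be switched so that it vanishes on the nonadjacent pairs
of neighbours, and on those of nonneighbours, of a given nonisolated vertex. -/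
theorem IsSigning.exists_normalized {s : V → V → ZMod 2} (hs : IsSigning G s)
    (hG : ∀ a b c, G.Adj a b → G.Adj b c → ¬ G.Adj a c) {v x₀ : V} (hx₀ : G.Adj v x₀) :
    ∃ t, IsSigning G t ∧ (∀ y z, ¬ G.Adj v y → ¬ G.Adj v z → Gᶜ.Adj y z → t y z = 0) ∧
      ∀ y z, G.Adj v y → G.Adj v z → y ≠ z → t y z = 0 := by
  classical
  have h2 (x : ZMod 2) : x + x = 0 := CharTwo.add_self_eq_zero x
  -- If `r` is nonadjacent to the rest of `A`, the triangles through `r` give s y z = s r y + s r z,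
  -- so on `A` the signing is a coboundary that switching by s r removes.
  have key {r : V} {A : Set V} {p : V → ZMod 2} (hp : ∀ y ∈ A, y ≠ r → p y = s r y)
      (hr : r ∈ A → p r = 0) (hrA : r ∈ A) (hA : ∀ y ∈ A, y ≠ r → Gᶜ.Adj r y)
      (y z : V) (hy : y ∈ A) (hz : z ∈ A) (hyz : Gᶜ.Adj y z) : s y z + p y + p z = 0 := by
    by_cases hyr : y = r
    · subst hyr
      rw [hr hrA, hp z hz hyz.ne', add_zero, h2]
    by_cases hzr : z = r
    · subst hzr
      rw [hr hrA, hp y hy hyr, add_zero, hs.symm, h2]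
    rw [hp y hy hyr, hp z hz hzr]
    have := hs.triangle r y z (hA y hy hyr) hyz (hA z hz hzr).symm
    rw [hs.symm z r] at this
    linear_combination this
  let p : V → ZMod 2 := fun y =>
    if G.Adj v y then (if y = x₀ then 0 else s x₀ y) else if y = v then 0 else s v y
  refine ⟨_, hs.switch p, ?_, ?_⟩
  · intro y z hy hz hyz
    refine key (r := v) (A := {y | ¬ G.Adj v y}) (p := p) ?_ ?_ ?_ ?_ y z hy hz hyz
    · intro y hy hyv
      simp only [Set.mem_ofPred_eq] at hy
      simp [p, hy, hyv]
    · intro _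
      simp [p]
    · simp
    · intro y hy hyv
      exact (compl_adj _ _ _).2 ⟨hyv.symm, hy⟩
  · intro y z hy hz hyz
    have hA (y z : V) (hy : G.Adj v y) (hz : G.Adj v z) (hne : y ≠ z) : Gᶜ.Adj y z :=
      (compl_adj _ _ _).2 ⟨hne, hG _ _ _ hy.symm hz⟩
    refine key (r := x₀) (A := {y | G.Adj v y}) (p := p) ?_ ?_ hx₀ ?_ y z hy hz (hA y z hy hz hyz)
    · intro y hy hyv
      simp only [Set.mem_ofPred_eq] at hy
      simp [p, hy, hyv]
    · intro _
      simp [p, hx₀]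
    · intro y hy hyv
      exact hA _ _ hx₀ hy hyv.symm

/-- A proper `3`-colouring without rainbow independent triples in which no two colour classes
contain an induced matching with two edges. -/
structure IsCircularColouring (G : SimpleGraph V) (c : V → ZMod 3) : Prop where
  proper : ∀ a b, G.Adj a b → c a ≠ c b
  rainbow : ∀ x y z, ¬ G.Adj x y → ¬ G.Adj y z → ¬ G.Adj x z →
    c x ≠ c y → c y ≠ c z → c x = c z
  matching : ∀ a b a' b', c a = c a' → c b = c b' → G.Adj a b → G.Adj a' b' → ¬ G.Adj a b' →
    G.Adj a' b

/-- A two-colouring of the nonneighbours of `v` gives a circular colouring. -/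
theorem isCircularColouring_of_nonneighbours {v : V} {s : V → V → ZMod 2} (hs : IsSigning G s)
    (hG : ∀ a b c, G.Adj a b → G.Adj b c → ¬ G.Adj a c)
    (hM : ∀ y z, ¬ G.Adj v y → ¬ G.Adj v z → Gᶜ.Adj y z → s y z = 0)
    (hN : ∀ y z, G.Adj v y → G.Adj v z → y ≠ z → s y z = 0)
    {m : V → ZMod 2} (hm : ∀ x y, G.Adj v x → ¬ G.Adj v y → ¬ G.Adj x y → m y = s x y)
    (hm' : ∀ y z, ¬ G.Adj v y → ¬ G.Adj v z → G.Adj y z → m y ≠ m z) :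
    ∃ c, IsCircularColouring G c := by
  classical
  let c : V → ZMod 3 := fun y => if G.Adj v y then 1 else if m y = 0 then 0 else 2
  have hcN {y : V} (hy : G.Adj v y) : c y = 1 := by simp [c, hy]
  have hcN' {y : V} (hy : ¬ G.Adj v y) : c y ≠ 1 := by
    simp only [c, hy, if_false]
    split_ifs <;> decide
  have hcM {y z : V} (hy : ¬ G.Adj v y) (hz : ¬ G.Adj v z) : c y = c z ↔ m y = m z := by
    simp only [c, hy, hz, if_false]
    generalize m y = a
    generalize m z = b
    revert a b
    decide
  have hcadj {y z : V} (h : c y = c z) : G.Adj v y ↔ G.Adj v z := by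
    constructor
    · intro hy
      by_contra hz
      exact hcN' hz (h ▸ hcN hy)
    · intro hy
      by_contra hz
      exact hcN' hz (h ▸ hcN hy)
  have hproper (a b : V) (hab : G.Adj a b) : c a ≠ c b := by
    intro h
    by_cases ha : G.Adj v a
    · exact hG _ _ _ ha hab ((hcadj h).1 ha)
    · have hb := fun hb => ha ((hcadj h).2 hb)
      exact hm' a b ha hb hab ((hcM ha hb).1 h)
  have hcompl {y z : V} (hne : y ≠ z) (h : ¬ G.Adj y z) : Gᶜ.Adj y z :=
    (compl_adj _ _ _).2 ⟨hne, h⟩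
  have hsame {x y z : V} (hx : G.Adj v x) (hy : ¬ G.Adj v y) (hz : ¬ G.Adj v z)
      (hxy : ¬ G.Adj x y) (hxz : ¬ G.Adj x z) (hyz : ¬ G.Adj y z) : c y = c z := by
    rw [hcM hy hz, hm x y hx hy hxy, hm x z hx hz hxz]
    rcases eq_or_ne y z with rfl | hne
    · rfl
    have h := hs.triangle x y z (hcompl (by rintro rfl; exact hy hx) hxy) (hcompl hne hyz)
      (hcompl (by rintro rfl; exact hz hx) hxz).symm
    rw [hM y z hy hz (hcompl hne hyz), add_zero, hs.symm z x, CharTwo.add_eq_zero] at h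
    exact h
  -- An induced matching a b, a' b' in G is the square a a' b b' in the complement.
  have hfar {a b a' b' : V} (h₁ : c a = c a') (h₂ : c b = c b') (hab : G.Adj a b)
      (hab' : G.Adj a' b') (h : ¬ G.Adj a b') (h' : ¬ G.Adj a' b) :
      s a a' + s a' b + s b b' + s b' a = 1 := by
    refine hs.square a a' b b' (hcompl ?_ fun h => hproper _ _ h h₁) (hcompl ?_ h')
      (hcompl ?_ fun h => hproper _ _ h h₂) (hcompl ?_ h).symm hab hab'
    · rintro rfl; exact h hab'
    · rintro rfl; exact hproper _ _ hab h₁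
    · rintro rfl; exact h hab
    · rintro rfl; exact hproper _ _ hab h₂.symm
  have hmix {a b a' b' : V} (h₁ : c a = c a') (h₂ : c b = c b') (hab : G.Adj a b)
      (hab' : G.Adj a' b') (h : ¬ G.Adj a b') (h' : ¬ G.Adj a' b) (ha : G.Adj v a)
      (hb : ¬ G.Adj v b) : False := by
    have ha' := (hcadj h₁).1 ha
    have hb' := fun hb' => hb ((hcadj h₂).2 hb')
    have hsum := hfar h₁ h₂ hab hab' h h'
    rw [hN a a' ha ha' (by rintro rfl; exact h hab'),
      hM b b' hb hb' (hcompl (by rintro rfl; exact h hab) fun h => hproper _ _ h h₂),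
      hs.symm b' a, ← hm a' b ha' hb h', ← hm a b' ha hb' h, (hcM hb hb').1 h₂] at hsum
    generalize m b' = x at hsum
    revert x
    decide
  refine ⟨c, hproper, ?_, ?_⟩
  · intro x y z hxy hyz hxz cxy cyz
    by_contra cxz
    by_cases hx : G.Adj v x
    · exact cyz (hsame hx (fun h => cxy ((hcN hx).trans (hcN h).symm))
        (fun h => cxz ((hcN hx).trans (hcN h).symm)) hxy hxz hyz)
    by_cases hy : G.Adj v y
    · exact cxz (hsame hy hx (fun h => cyz ((hcN hy).trans (hcN h).symm))
        (fun h => hxy h.symm) hyz hxz)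
    by_cases hz : G.Adj v z
    · exact cxy (hsame hz hx hy (fun h => hxz h.symm) (fun h => hyz h.symm) hxy)
    rw [← Ne, Ne, hcM hx hz] at cxz
    rw [Ne, hcM hx hy] at cxy
    rw [Ne, hcM hy hz] at cyz
    generalize m x = i at *
    generalize m y = j at *
    generalize m z = k at *
    clear * - cxz cxy cyz
    revert i j k
    decide
  · intro a b a' b' h₁ h₂ hab hab' h
    by_contra h'
    by_cases ha : G.Adj v a
    · exact hmix h₁ h₂ hab hab' h h' ha (fun hb => hproper _ _ hab ((hcN ha).trans (hcN hb).symm))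
    by_cases hb : G.Adj v b
    · exact hmix h₂ h₁ hab.symm hab'.symm (fun h => h' h.symm) (fun h'' => h h''.symm) hb ha
    have ha' := fun ha' => ha ((hcadj h₁).2 ha')
    have hb' := fun hb' => hb ((hcadj h₂).2 hb')
    have hsum := hfar h₁ h₂ hab hab' h h'
    rw [hM a a' ha ha' (hcompl (by rintro rfl; exact h hab') fun h => hproper _ _ h h₁),
      hM a' b ha' hb (hcompl (by rintro rfl; exact hproper _ _ hab h₁) h'),
      hM b b' hb hb' (hcompl (by rintro rfl; exact h hab) fun h => hproper _ _ h h₂),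
      hM b' a hb' ha (hcompl (by rintro rfl; exact hproper _ _ hab h₂.symm)
        fun h'' => h h''.symm)] at hsum
    revert hsum
    decide

/-- A triangle-free graph whose complement is anti-even-signable has a circular colouring. -/
theorem exists_isCircularColouring (hG : ∀ a b c, G.Adj a b → G.Adj b c → ¬ G.Adj a c)
    (h : AntiEvenSignable Gᶜ) : ∃ c, IsCircularColouring G c := by
  classical
  by_cases hE : ∃ v x, G.Adj v x
  swap
  · push Not at hE
    exact ⟨0, fun a b h => (hE a b h).elim, fun _ _ _ _ _ _ _ _ => rfl,
      fun a b _ _ _ _ h => (hE a b h).elim⟩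
  obtain ⟨v, x₀, hx₀⟩ := hE
  obtain ⟨s₀, hs₀⟩ := exists_isSigning h
  obtain ⟨s, hs, hM, hN⟩ := hs₀.exists_normalized hG hx₀
  have hcompl {y z : V} (hne : y ≠ z) (h : ¬ G.Adj y z) : Gᶜ.Adj y z :=
    (compl_adj _ _ _).2 ⟨hne, h⟩
  have hNM {x y : V} (hx : G.Adj v x) (hy : ¬ G.Adj v y) : x ≠ y := by
    rintro rfl
    exact hy hx
  -- If `y` is joined to all of N(v), no label to N(v) is available, so `m y` is chosen opposite to
  -- the value at a nonneighbour of `v` adjacent to `y`. The final 0 is arbitrary: no such vertex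
  -- constrains it.
  let m : V → ZMod 2 := fun y =>
    if h : ∃ x, G.Adj v x ∧ ¬ G.Adj x y then s h.choose y
    else if h : ∃ z, ¬ G.Adj v z ∧ G.Adj y z then s x₀ h.choose + 1 else 0
  have hm (x y : V) (hx : G.Adj v x) (hy : ¬ G.Adj v y) (hxy : ¬ G.Adj x y) : m y = s x y := by
    have hex : ∃ x, G.Adj v x ∧ ¬ G.Adj x y := ⟨x, hx, hxy⟩
    have hw := hex.choose_spec
    simp only [m, dif_pos hex]
    generalize hex.choose = w at hw
    rcases eq_or_ne w x with rfl | hne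
    · rfl
    have h := hs.triangle w x y (hcompl hne (hG _ _ _ hw.1.symm hx)) (hcompl (hNM hx hy) hxy)
      (hcompl (hNM hw.1 hy) hw.2).symm
    rw [hN w x hw.1 hx hne, zero_add, hs.symm y w, CharTwo.add_eq_zero] at h
    exact h.symm
  have hcomplete (y z : V) (hy : ¬ G.Adj v y) (hz : ¬ G.Adj v z) (hyz : G.Adj y z)
      (hall : ∀ x, G.Adj v x → G.Adj x y) : m y ≠ m z := by
    have hne : ¬ ∃ x, G.Adj v x ∧ ¬ G.Adj x y := by
      rintro ⟨x, hx, hxy⟩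
      exact hxy (hall x hx)
    have hex : ∃ z, ¬ G.Adj v z ∧ G.Adj y z := ⟨z, hz, hyz⟩
    have hw := hex.choose_spec
    rw [hm x₀ z hx₀ hz (hG _ _ _ (hall x₀ hx₀) hyz)]
    simp only [m, dif_neg hne, dif_pos hex]
    generalize hex.choose = w at hw
    -- All G-neighbours of `y` outside N(v) get the same value, so the choice of `w` is immaterial.
    have hwz : s x₀ w = s x₀ z := by
      rcases eq_or_ne w z with rfl | hne
      · rfl
      have hwz := hcompl hne (hG _ _ _ hw.2.symm hyz)
      have h := hs.triangle x₀ w z (hcompl (hNM hx₀ hw.1) (hG _ _ _ (hall x₀ hx₀) hw.2)) hwz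
        (hcompl (hNM hx₀ hz) (hG _ _ _ (hall x₀ hx₀) hyz)).symm
      rw [hM w z hw.1 hz hwz, add_zero, hs.symm z x₀, CharTwo.add_eq_zero] at h
      exact h
    rw [hwz]
    simp
  refine isCircularColouring_of_nonneighbours hs hG hM hN hm ?_
  intro y z hy hz hyz
  by_cases hally : ∀ x, G.Adj v x → G.Adj x y
  · exact hcomplete y z hy hz hyz hally
  by_cases hallz : ∀ x, G.Adj v x → G.Adj x z
  · exact (hcomplete z y hz hy hyz.symm hallz).symm
  have hvy : v ≠ y := by
    rintro rfl
    exact hz hyz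
  have hvz : v ≠ z := by
    rintro rfl
    exact hy hyz.symm
  by_cases hboth : ∃ x, G.Adj v x ∧ ¬ G.Adj x y ∧ ¬ G.Adj x z
  · obtain ⟨x, hx, hxy, hxz⟩ := hboth
    rw [hm x y hx hy hxy, hm x z hx hz hxz]
    have hvy' := hcompl hvy hy
    have hvz' := hcompl hvz hz
    have h := hs.square v y x z hvy' (hcompl (hNM hx hy) hxy).symm (hcompl (hNM hx hz) hxz)
      hvz'.symm hx hyz
    rw [hM v y (G.irrefl) hy hvy', hM z v hz G.irrefl hvz'.symm, hs.symm y x] at h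
    intro heq
    rw [heq] at h
    generalize s x z = i at h
    revert i
    decide
  · push Not at hally hallz hboth
    obtain ⟨x, hx, hxz⟩ := hallz
    obtain ⟨w, hw, hwy⟩ := hally
    have hxy : G.Adj x y := by
      by_contra hxy
      exact hxz (hboth x hx hxy)
    have hwz := hboth w hw hwy
    have hvy' := hcompl hvy hy
    have hvz' := hcompl hvz hz
    have hwx : w ≠ x := by
      rintro rfl
      exact hwy hxy
    rw [hm w y hw hy hwy, hm x z hx hz hxz]
    -- After normalization only the labels of w y and x z survive, so they differ.
    have h := hs.pentagon v y w x z hvy' (hcompl (hNM hw hy) hwy).symm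
      (hcompl hwx (hG _ _ _ hw.symm hx)) (hcompl (hNM hx hz) hxz) hvz'.symm hw hxy.symm hwz
      hx.symm hyz.symm
    rw [hM v y (G.irrefl) hy hvy', hM z v hz G.irrefl hvz'.symm, hs.symm y w,
      hN w x hw hx hwx] at h
    intro heq
    rw [heq] at h
    generalize s x z = i at h
    revert i
    decide

end Colouring

/-! ### From circular colourings to rational angles -/

section Realization

variable {G : SimpleGraph V}

theorem ZMod.eq_add_one_iff_of_ne {a b : ZMod 3} (h : a ≠ b) : b = a + 1 ↔ ¬ a = b + 1 := by
  revert a b; decide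

theorem ZMod.eq_add_one_iff_of_rainbow {a b c : ZMod 3} (hab : a ≠ b) (hbc : b ≠ c) (hac : a ≠ c) :
    (c = b + 1 ↔ b = a + 1) ∧ (a = c + 1 ↔ b = a + 1) := by
  revert a b c; decide

/-- For a circular colouring `c` there is a linear order for which `x < y` are adjacent if and only
if `c y = c x + 1`. -/
theorem IsCircularColouring.exists_linearOrder {c : V → ZMod 3} (hc : IsCircularColouring G c)
    (hG : ∀ a b c, G.Adj a b → G.Adj b c → ¬ G.Adj a c) :
    ∃ _ : LinearOrder V, ∀ x y, x < y → (G.Adj x y ↔ c y = c x + 1) := by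
  -- `D` records the order forced on differently coloured pairs; exactly one direction holds for
  -- each.
  let D : V → V → Prop := fun x y => c x ≠ c y ∧ (G.Adj x y ↔ c y = c x + 1)
  have hasymm {x y : V} (h : D x y) (h' : D y x) : False := by
    have h₁ := h.2
    rw [G.adj_comm, h'.2, ZMod.eq_add_one_iff_of_ne h.1] at h₁
    tauto
  have htotal {x y : V} (h : c x ≠ c y) : D x y ∨ D y x := by
    have h₁ := ZMod.eq_add_one_iff_of_ne h
    have h₂ := G.adj_comm x y
    by_cases h₃ : G.Adj x y ↔ c y = c x + 1
    · exact Or.inl ⟨h, h₃⟩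
    · exact Or.inr ⟨h.symm, by tauto⟩
  -- A directed rainbow 3-cycle would be either a triangle of G or a rainbow independent triple.
  have htrans {x y z : V} (h₁ : D x y) (h₂ : D y z) (hxz : c x ≠ c z) : D x z := by
    refine (htotal hxz).resolve_right fun h₃ => ?_
    obtain ⟨hyz, hzx⟩ := ZMod.eq_add_one_iff_of_rainbow h₁.1 h₂.1 hxz
    by_cases hxy : c y = c x + 1
    · exact hG x y z (h₁.2.2 hxy) (h₂.2.2 (hyz.2 hxy)) (h₃.2.2 (hzx.2 hxy)).symm
    · exact hxz (hc.rainbow x y z (fun h => hxy (h₁.2.1 h)) (fun h => hxy (hyz.1 (h₂.2.1 h)))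
        (fun h => hxy (hzx.1 (h₃.2.1 h.symm))) h₁.1 h₂.1)
  -- Around a directed two-coloured 4-cycle, edges and nonedges would alternate, giving a forbidden
  -- induced matching.
  have hfour {x y z w : V} (h₁ : D x y) (h₂ : D y z) (h₃ : D z w) (hxz : c x = c z)
      (hyw : c y = c w) : D x w := by
    refine (htotal (by rw [← hyw]; exact h₁.1)).resolve_right fun h₄ => ?_
    by_cases hxy : c y = c x + 1
    · have h₂' : ¬ G.Adj y z := fun h => by
        have h := h₂.2.1 h
        rw [← hxz] at h
        exact (ZMod.eq_add_one_iff_of_ne h₁.1).1 hxy h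
      have h₄' : ¬ G.Adj w x := fun h => by
        have h := h₄.2.1 h
        rw [← hyw] at h
        exact (ZMod.eq_add_one_iff_of_ne h₁.1).1 hxy h
      exact h₂' (hc.matching x y z w hxz hyw (h₁.2.2 hxy)
        (h₃.2.2 (by rw [← hyw, ← hxz, hxy])) (fun h => h₄' h.symm)).symm
    · have hyx := (ZMod.eq_add_one_iff_of_ne h₁.1.symm).2 hxy
      have h₃' : ¬ G.Adj z w := fun h => hxy (by rw [hyw, hxz]; exact h₃.2.1 h)
      have hx := hc.matching y z w x hyw hxz.symm (h₂.2.2 (by rw [← hxz, hyx]))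
        (h₄.2.2 (by rw [← hyw, hyx])) (fun h => hxy (h₁.2.1 h.symm))
      exact h₃' hx.symm
  -- Two-step paths suffice to make `D` transitive, since three-step paths reduce by `hDDD` and
  -- `hDDD'`.
  let R : V → V → Prop := fun x z => D x z ∨ (c x = c z ∧ ∃ y, D x y ∧ D y z)
  have hDD {x y z : V} (h₁ : D x y) (h₂ : D y z) : R x z := by
    by_cases hxz : c x = c z
    · exact Or.inr ⟨hxz, y, h₁, h₂⟩
    · exact Or.inl (htrans h₁ h₂ hxz)
  have hDDD {x y z w : V} (h₁ : D x y) (h₂ : D y z) (hxz : c x = c z) (h₃ : D z w) : D x w := by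
    have hxw : c x ≠ c w := by rw [hxz]; exact h₃.1
    by_cases hyw : c y = c w
    · exact hfour h₁ h₂ h₃ hxz hyw
    · exact htrans h₁ (htrans h₂ h₃ hyw) hxw
  have hDDD' {x y z w : V} (h₁ : D x y) (h₂ : D y z) (hyw : c y = c w) (h₃ : D z w) : D x w := by
    have hxw : c x ≠ c w := by rw [← hyw]; exact h₁.1
    by_cases hxz : c x = c z
    · exact hfour h₁ h₂ h₃ hxz hyw
    · exact htrans (htrans h₁ h₂ hxz) h₃ hxw
  have hR : IsStrictOrder V R :=
    { irrefl := by
        rintro x (h | ⟨-, y, h₁, h₂⟩)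
        · exact h.1 rfl
        · exact hasymm h₁ h₂
      trans := by
        rintro x y z (h₁ | ⟨hxy, a, h₁, h₂⟩) (h₃ | ⟨hyz, b, h₃, h₄⟩)
        · exact hDD h₁ h₃
        · exact Or.inl (hDDD' h₁ h₃ hyz h₄)
        · exact Or.inl (hDDD h₁ h₂ hxy h₃)
        · exact Or.inr ⟨hxy.trans hyz, b, hDDD h₁ h₂ hxy h₃, h₄⟩ }
  let po : PartialOrder V := partialOrderOfSO R
  let lo : LinearOrder V := inferInstanceAs (LinearOrder (LinearExtension V))
  have hlt {x y : V} (h : R x y) : lo.lt x y := by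
    have hle : po.le x y := Or.inr h
    have hne : x ≠ y := by
      rintro rfl
      exact hR.irrefl _ h
    exact lt_of_le_of_ne (toLinearExtension.monotone hle) hne
  refine ⟨lo, fun x y hxy => ?_⟩
  by_cases hne : c x = c y
  · refine iff_of_false (fun h => hc.proper _ _ h hne) ?_
    rw [hne, left_eq_add]
    decide
  · exact ((htotal hne).resolve_right fun h => @lt_asymm V lo.toPreorder x y hxy (hlt (Or.inl h))).2

/-- A countable graph with such an order and colouring is represented by rational points. -/
theorem exists_rational_angles [Countable V] [LinearOrder V] {c : V → ZMod 3}
    (h : ∀ x y, x < y → (G.Adj x y ↔ c y = c x + 1)) :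
    ∃ θ : V → ℝ, Function.Injective θ ∧ (∀ v, ∃ q : ℚ, θ v = q) ∧
      (∀ v, θ v ∈ Set.Ioc (-Real.pi) Real.pi) ∧
      ∀ u v, G.Adj u v ↔
        2 / 3 * Real.pi < |θ u - θ v| ∧ |θ u - θ v| < 4 / 3 * Real.pi := by
  have hpi := Real.pi_pos
  have : Nontrivial (Set.Ioo 0 (2 / 3 * Real.pi)) :=
    ⟨⟨⟨Real.pi / 3, by constructor <;> linarith⟩, ⟨Real.pi / 2, by constructor <;> linarith⟩,
      fun h => by
        have := congrArg Subtype.val h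
        dsimp only at this
        linarith⟩⟩
  have : Countable (V ×ₗ Bool) := inferInstanceAs (Countable (V × Bool))
  -- The factor `Bool` gives each vertex an interval rather than a point: the arcs start at
  -- multiples of π, so the rational angle must be chosen after shifting.
  obtain ⟨f⟩ := Order.embedding_from_countable_to_dense (V ×ₗ Bool)
    (Set.Ioo 0 (2 / 3 * Real.pi))
  have hq (v : V) : ∃ q : ℚ, (f (toLex (v, false))).1 + (c v).val * (2 / 3 * Real.pi) - Real.pi < q ∧
      q < (f (toLex (v, true))).1 + (c v).val * (2 / 3 * Real.pi) - Real.pi := by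
    refine exists_rat_btwn ?_
    have : f (toLex (v, false)) < f (toLex (v, true)) := by
      rw [f.lt_iff_lt, Prod.Lex.toLex_lt_toLex]
      exact Or.inr ⟨rfl, Bool.false_lt_true⟩
    have : (f (toLex (v, false))).1 < (f (toLex (v, true))).1 := this
    linarith
  choose q hq hq' using hq
  obtain ⟨t, ht⟩ : ∃ t : V → ℝ, ∀ v, t v = q v - (c v).val * (2 / 3 * Real.pi) + Real.pi :=
    ⟨_, fun v => rfl⟩
  have ht₀ (v : V) : 0 < t v := by
    have := (f (toLex (v, false))).2.1
    linarith [hq v, ht v]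
  have ht₁ (v : V) : t v < 2 / 3 * Real.pi := by
    have := (f (toLex (v, true))).2.2
    linarith [hq' v, ht v]
  have htlt {u v : V} (huv : u < v) : t u < t v := by
    have : f (toLex (u, true)) < f (toLex (v, false)) := by
      rw [f.lt_iff_lt, Prod.Lex.toLex_lt_toLex]
      exact Or.inl huv
    have : (f (toLex (u, true))).1 < (f (toLex (v, false))).1 := this
    linarith [hq' u, hq v, ht u, ht v]
  have hval (v : V) : c v = 0 ∧ (q v : ℝ) = t v - Real.pi ∨
      c v = 1 ∧ (q v : ℝ) = t v + 2 / 3 * Real.pi - Real.pi ∨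
      c v = 2 ∧ (q v : ℝ) = t v + 4 / 3 * Real.pi - Real.pi := by
    have hv := ht v
    have h3 (i : ZMod 3) : i = 0 ∧ i.val = 0 ∨ i = 1 ∧ i.val = 1 ∨ i = 2 ∧ i.val = 2 := by
      revert i; decide
    rcases h3 (c v) with h | h | h <;> rw [h.2] at hv <;> push_cast at hv
    · exact Or.inl ⟨h.1, by linarith⟩
    · exact Or.inr (Or.inl ⟨h.1, by linarith⟩)
    · exact Or.inr (Or.inr ⟨h.1, by linarith⟩)
  have hlt {u v : V} (huv : u < v) : (q u : ℝ) ≠ q v ∧ (G.Adj u v ↔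
        2 / 3 * Real.pi < |(q u : ℝ) - q v| ∧ |(q u : ℝ) - q v| < 4 / 3 * Real.pi) := by
    rw [h u v huv]
    have h₁ := htlt huv
    have h₂ := ht₀ u
    have h₃ := ht₁ v
    rcases hval u with ⟨hu, hu'⟩ | ⟨hu, hu'⟩ | ⟨hu, hu'⟩ <;>
    rcases hval v with ⟨hv, hv'⟩ | ⟨hv, hv'⟩ | ⟨hv, hv'⟩ <;>
    rw [hu, hv, hu', hv'] <;> refine ⟨by intro h; linarith, ?_⟩ <;>
    first
    | refine iff_of_true (by decide) ?_
      rw [lt_abs, abs_lt]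
      exact ⟨by first | (left; linarith) | (right; linarith), by linarith, by linarith⟩
    | refine iff_of_false (by decide) ?_
      rintro ⟨h₄, h₅⟩
      rw [lt_abs] at h₄
      rw [abs_lt] at h₅
      rcases h₄ with h₄ | h₄ <;> linarith
  refine ⟨fun v => q v, ?_, fun v => ⟨q v, rfl⟩, fun v => ?_, fun u v => ?_⟩
  · intro u v huv
    by_contra hne
    rcases lt_or_gt_of_ne hne with h | h
    · exact (hlt h).1 huv
    · exact (hlt h).1 huv.symm
  · have h₂ := ht₀ v
    have h₃ := ht₁ v
    rcases hval v with ⟨-, hv⟩ | ⟨-, hv⟩ | ⟨-, hv⟩ <;> constructor <;> linarith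
  · rcases lt_trichotomy u v with h | rfl | h
    · exact (hlt h).2
    · refine iff_of_false G.irrefl fun h => ?_
      rw [sub_self, abs_zero] at h
      linarith [h.1]
    · rw [G.adj_comm, abs_sub_comm]
      exact (hlt h).2

end Realization

/-! ### Adjacency in terms of angles -/

variable {G : SimpleGraph V}

/-- Since |α - β| < 2π, at most one full turn is removed by `arg`; the upper bound 4π/3 accounts for
that case. -/
theorem exp_div_exp_arg {α β : ℝ} (hα : α ∈ Set.Ioc (-Real.pi) Real.pi)
    (hβ : β ∈ Set.Ioc (-Real.pi) Real.pi) :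
    2 / 3 * Real.pi < |(Complex.exp (α * Complex.I) / Complex.exp (β * Complex.I)).arg| ↔
      2 / 3 * Real.pi < |α - β| ∧ |α - β| < 4 / 3 * Real.pi := by
  have hpi := Real.pi_pos
  obtain ⟨h₁, h₂⟩ := hα
  obtain ⟨h₃, h₄⟩ := hβ
  have harg : Complex.exp (α * Complex.I) / Complex.exp (β * Complex.I) =
      Complex.exp ((α - β : ℝ) * Complex.I) := by
    rw [← Complex.exp_sub]
    push_cast
    ring_nf
  rw [harg, Complex.arg_exp_mul_I]
  have hmod (z : ℤ) (hz : α - β - z * (2 * Real.pi) ∈ Set.Ioc (-Real.pi) Real.pi) :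
      toIocMod Real.two_pi_pos (-Real.pi) (α - β) = α - β - z * (2 * Real.pi) := by
    rw [toIocMod_eq_iff]
    refine ⟨⟨hz.1, by linarith [hz.2]⟩, z, ?_⟩
    rw [zsmul_eq_mul]
    ring
  by_cases hgt : Real.pi < α - β
  · rw [hmod 1 (by push_cast; constructor <;> linarith), lt_abs, lt_abs, abs_lt]
    push_cast
    constructor
    · rintro (h | h)
      · linarith
      · exact ⟨Or.inl (by linarith), by linarith, by linarith⟩
    · rintro ⟨-, h⟩
      exact Or.inr (by linarith)
  by_cases hlt : α - β ≤ -Real.pi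
  · rw [hmod (-1) (by push_cast; constructor <;> linarith), lt_abs, lt_abs, abs_lt]
    push_cast
    constructor
    · rintro (h | h)
      · exact ⟨Or.inr (by linarith), by linarith, by linarith⟩
      · linarith
    · rintro ⟨-, h⟩
      exact Or.inl (by linarith)
  · rw [hmod 0 (by push_cast; constructor <;> linarith)]
    push_cast
    rw [zero_mul, sub_zero]
    refine ⟨fun h => ⟨h, abs_lt.2 ⟨by linarith, by linarith⟩⟩, fun h => h.1⟩

theorem Vertex.exp_arg (z : Vertex) : Complex.exp (z.1.arg * Complex.I) = z.1 := by
  have h := Complex.norm_mul_exp_arg_mul_I z.1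
  rwa [z.2.1, Complex.ofReal_one, one_mul] at h

theorem genericGraph_adj_iff (z w : Vertex) :
    genericGraph.Adj z w ↔
      2 / 3 * Real.pi < |z.1.arg - w.1.arg| ∧ |z.1.arg - w.1.arg| < 4 / 3 * Real.pi := by
  rw [← exp_div_exp_arg z.1.arg_mem_Ioc w.1.arg_mem_Ioc, z.exp_arg, w.exp_arg]
  rfl

theorem nonempty_embedding_of_angles {θ : V → ℝ} (hinj : Function.Injective θ)
    (hq : ∀ v, ∃ q : ℚ, θ v = q) (hθ : ∀ v, θ v ∈ Set.Ioc (-Real.pi) Real.pi)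
    (hadj : ∀ u v, G.Adj u v ↔
      2 / 3 * Real.pi < |θ u - θ v| ∧ |θ u - θ v| < 4 / 3 * Real.pi) :
    Nonempty (G ↪g genericGraph) := by
  have harg (v : V) : (Complex.exp (θ v * Complex.I)).arg = θ v := by
    rw [Complex.arg_exp_mul_I, toIocMod_eq_self]
    exact ⟨(hθ v).1, by linarith [(hθ v).2]⟩
  let f : V → Vertex := fun v => ⟨Complex.exp (θ v * Complex.I),
    Complex.norm_exp_ofReal_mul_I _, by rw [harg]; exact hq v⟩
  have hf (v : V) : (f v).1.arg = θ v := harg v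
  exact ⟨{ toFun := f
           inj' := fun u v huv => hinj (by rw [← hf u, huv, hf])
           map_rel_iff' := by
             intro u v
             change genericGraph.Adj (f u) (f v) ↔ _
             rw [genericGraph_adj_iff, hf, hf, hadj] }⟩

/-! ### Winding numbers of induced cycles in the complement -/

/-- The number of turns by which the difference of two angles in `(-π, π]` has to be changed to
bring it into `[-π, π]`. -/
def turn (α β : ℝ) : ℤ := if Real.pi < α - β then -1 else if α - β < -Real.pi then 1 else 0

theorem turn_swap (α β : ℝ) : turn β α = -turn α β := by
  have := Real.pi_pos
  unfold turn
  split_ifs <;> first | rfl | (exfalso; linarith)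

theorem abs_add_turn_lt {α β : ℝ} (hα : α ∈ Set.Ioc (-Real.pi) Real.pi)
    (hβ : β ∈ Set.Ioc (-Real.pi) Real.pi)
    (h : |α - β| < 2 / 3 * Real.pi ∨ 4 / 3 * Real.pi < |α - β|) :
    |α - β + 2 * Real.pi * turn α β| < 2 / 3 * Real.pi := by
  have hpi := Real.pi_pos
  obtain ⟨h₁, h₂⟩ := hα
  obtain ⟨h₃, h₄⟩ := hβ
  rw [abs_lt, lt_abs] at h
  unfold turn
  rw [abs_lt]
  split_ifs <;> push_cast <;> rcases h with h | h | h <;> constructor <;> linarith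

/-- For k ≠ 0 the shift is at least 2π in absolute value, and 2π - 4π/3 = 2π/3. Thus adjacent
vertices stay far apart in every lift to the line. -/
theorem lt_abs_add_int {d : ℝ} (h : 2 / 3 * Real.pi < |d|) (h' : |d| < 4 / 3 * Real.pi) (k : ℤ) :
    2 / 3 * Real.pi < |d + 2 * Real.pi * k| := by
  have hpi := Real.pi_pos
  rcases eq_or_ne k 0 with rfl | hk
  · simpa using h
  have hk' : (1 : ℝ) ≤ |(k : ℝ)| := by exact_mod_cast Int.one_le_abs hk
  have h₁ : |2 * Real.pi * k| ≤ |d + 2 * Real.pi * k| + |d| := by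
    have := abs_sub (d + 2 * Real.pi * k) d
    rwa [add_sub_cancel_left] at this
  rw [abs_mul, abs_of_pos Real.two_pi_pos] at h₁
  nlinarith

theorem rat_abs_ne_mul_pi {α β : ℝ} (hα : ∃ q : ℚ, α = q) (hβ : ∃ q : ℚ, β = q) {r : ℚ}
    (hr : r ≠ 0) : |α - β| ≠ r * Real.pi := by
  obtain ⟨p, rfl⟩ := hα
  obtain ⟨q, rfl⟩ := hβ
  intro h
  refine (irrational_pi.ratCast_mul hr).ne_rat |p - q| ?_
  rw [← h]
  push_cast
  rfl

/-- An integer-valued function with sum `0` on a cycle has a potential. -/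
theorem exists_potential {n : ℕ} (κ : Fin (n + 1) → ℤ) (h : ∑ i, κ i = 0) :
    ∃ S : Fin (n + 1) → ℤ, ∀ i, S (i + 1) = S i + κ i := by
  -- Partial sums; the zero total is needed only at the wrap-around from the last index.
  refine ⟨fun i => ∑ j ∈ Finset.range i, κ (Fin.ofNat (n + 1) j), fun i => ?_⟩
  have hi : κ i = κ (Fin.ofNat (n + 1) i) := by simp
  dsimp only
  rw [hi, ← Finset.sum_range_succ, Fin.val_add_one]
  split_ifs with hlast
  · rw [hlast, Fin.val_last, Finset.range_zero, Finset.sum_empty, Finset.sum_range]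
    simpa using h.symm
  · rfl

/-- On a cycle of length at least 6, positions 0, 2, 4 are pairwise nonconsecutive and would form a
triangle of G. -/
theorem le_two_of_cycle_compl (hG : ∀ a b c, G.Adj a b → G.Adj b c → ¬ G.Adj a c) {n : ℕ}
    (f : cycleGraph (n + 3) ↪g Gᶜ) : n ≤ 2 := by
  by_contra! hn
  have hadj (i j : Fin (n + 3)) (hij : i < j) (h₁ : j.val - i.val ≠ 1)
      (h₂ : n + 3 + i.val - j.val ≠ 1) : G.Adj (f i) (f j) := by
    by_contra h
    have hc : Gᶜ.Adj (f i) (f j) := (compl_adj _ _ _).2 ⟨fun h => hij.ne (f.injective h), h⟩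
    rw [f.map_adj_iff, cycleGraph_adj', Fin.coe_sub_iff_lt.2 hij, Fin.coe_sub_iff_le.2 hij.le] at hc
    omega
  refine hG (f ⟨0, by omega⟩) (f ⟨2, by omega⟩) (f ⟨4, by omega⟩) ?_ ?_ ?_ <;>
  · refine hadj _ _ (by simp [Fin.lt_def]) ?_ ?_ <;> dsimp only <;> omega

/-- A cyclic sequence of reals whose consecutive terms are near has near terms two steps apart,
namely those around a minimal term. -/
theorem exists_abs_sub_lt {n : ℕ} [NeZero n] (x : Fin n → ℝ) {r : ℝ}
    (hx : ∀ i, |x i - x (i + 1)| < r) : ∃ i, |x i - x (i + 1 + 1)| < r := by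
  obtain ⟨i, hi⟩ := Finite.exists_min x
  refine ⟨i - 1, ?_⟩
  have h₁ := hx (i - 1)
  have h₂ := hx i
  rw [sub_add_cancel]
  rw [sub_add_cancel] at h₁
  have h₃ := hi (i - 1)
  have h₄ := hi (i + 1)
  rw [abs_lt] at *
  constructor <;> linarith

theorem antiEvenSignable_of_angles {θ : V → ℝ}
    (hG : ∀ a b c, G.Adj a b → G.Adj b c → ¬ G.Adj a c)
    (hq : ∀ v, ∃ q : ℚ, θ v = q) (hθ : ∀ v, θ v ∈ Set.Ioc (-Real.pi) Real.pi)
    (hadj : ∀ u v, G.Adj u v ↔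
      2 / 3 * Real.pi < |θ u - θ v| ∧ |θ u - θ v| < 4 / 3 * Real.pi) :
    AntiEvenSignable Gᶜ := by
  have hpi := Real.pi_pos
  have hnear {u v : V} (h : Gᶜ.Adj u v) :
      |θ u - θ v + 2 * Real.pi * turn (θ u) (θ v)| < 2 / 3 * Real.pi := by
    refine abs_add_turn_lt (hθ u) (hθ v) ?_
    have h₁ := rat_abs_ne_mul_pi (hq u) (hq v) (r := 2 / 3) (by norm_num)
    have h₂ := rat_abs_ne_mul_pi (hq u) (hq v) (r := 4 / 3) (by norm_num)
    push_cast at h₁ h₂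
    have h₃ := ((compl_adj _ _ _).1 h).2
    rw [hadj, not_and_or, not_lt, not_lt] at h₃
    exact h₃.imp (fun h => lt_of_le_of_ne h h₁) fun h => lt_of_le_of_ne h h₂.symm
  -- `turn` is antisymmetric, so its parity labels unordered pairs.
  have hsymm (u v : V) : (turn (θ u) (θ v) : ZMod 2) = turn (θ v) (θ u) := by
    rw [turn_swap (θ v) (θ u), Int.cast_neg, ZMod.neg_eq_self_mod_two]
  refine antiEvenSignable_iff.2
    ⟨Sym2.lift ⟨fun u v => (turn (θ u) (θ v) : ZMod 2), hsymm⟩, fun n f => ?_⟩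
  have hn := le_two_of_cycle_compl hG f
  have hcyc (i : Fin (n + 3)) : Gᶜ.Adj (f i) (f (i + 1)) := by
    rw [f.map_adj_iff, cycleGraph_adj]
    right
    simp
  obtain ⟨κ, hκ⟩ : ∃ κ : Fin (n + 3) → ℤ, ∀ i, κ i = turn (θ (f i)) (θ (f (i + 1))) :=
    ⟨_, fun i => rfl⟩
  have hstep (i : Fin (n + 3)) :
      |θ (f i) - θ (f (i + 1)) + 2 * Real.pi * κ i| < 2 / 3 * Real.pi := by
    rw [hκ]
    exact hnear (hcyc i)
  have hsum : ∑ i, (θ (f i) - θ (f (i + 1)) + 2 * Real.pi * κ i) =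
      2 * Real.pi * (∑ i, κ i : ℤ) := by
    have hshift : ∑ i, θ (f (i + 1)) = ∑ i, θ (f i) :=
      Equiv.sum_comp (Equiv.addRight (1 : Fin (n + 3))) fun i => θ (f i)
    rw [Finset.sum_add_distrib, Finset.sum_sub_distrib, hshift, sub_self, zero_add,
      ← Finset.mul_sum, Int.cast_sum]
  have hbound : |∑ i, κ i| * 3 < n + 3 := by
    have h₁ : |2 * Real.pi * ((∑ i, κ i : ℤ) : ℝ)| < (n + 3) * (2 / 3 * Real.pi) := by
      rw [← hsum]
      refine (Finset.abs_sum_le_sum_abs _ _).trans_lt ?_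
      refine (Finset.sum_lt_sum_of_nonempty Finset.univ_nonempty fun i _ => hstep i).trans_eq ?_
      simp
    rw [abs_mul, abs_of_pos Real.two_pi_pos] at h₁
    have h₂ : |((∑ i, κ i : ℤ) : ℝ)| * 3 < n + 3 := by
      refine lt_of_mul_lt_mul_right (a := 2 / 3 * Real.pi) ?_ (by positivity)
      linarith
    exact_mod_cast h₂
  -- With winding number 0, correcting by the potential `S` lifts the cycle to the line; two terms
  -- two steps apart are then near, although for n ≠ 0 they are adjacent in G.
  have hzero (h : ∑ i, κ i = 0) : n = 0 := by
    by_contra hn0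
    obtain ⟨S, hS⟩ := exists_potential κ h
    obtain ⟨i, hi⟩ := exists_abs_sub_lt (fun i => θ (f i) - 2 * Real.pi * S i)
      (r := 2 / 3 * Real.pi) fun i => by
        have := hstep i
        rw [hS]
        push_cast
        convert this using 2
        ring
    have hfar : G.Adj (f i) (f (i + 1 + 1)) := by
      have hv2 : ((1 + 1 : Fin (n + 3)) : ℕ) = 2 := by
        rw [Fin.val_add, Fin.val_one]
        exact Nat.mod_eq_of_lt (by omega)
      by_contra hcon
      have hne : i ≠ i + 1 + 1 := fun h => add_one_cancel_two h rfl
      have hc : Gᶜ.Adj (f i) (f (i + 1 + 1)) :=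
        (compl_adj _ _ _).2 ⟨fun h => hne (f.injective h), hcon⟩
      rw [f.map_adj_iff, cycleGraph_adj', add_assoc, sub_add_cancel_left, add_sub_cancel_left,
        hv2, Fin.val_neg, hv2] at hc
      split_ifs at hc with h0
      · rw [h0] at hv2
        simp at hv2
      · omega
    rw [hadj] at hfar
    have := lt_abs_add_int hfar.1 hfar.2 (S (i + 1 + 1) - S i)
    refine lt_asymm this ?_
    refine lt_of_eq_of_lt (congrArg abs ?_) hi
    push_cast
    ring
  have hgoal : ∑ i, Sym2.lift ⟨fun u v => (turn (θ u) (θ v) : ZMod 2), hsymm⟩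
      s(f i, f (i + 1)) = ((∑ i, κ i : ℤ) : ZMod 2) := by
    simp [hκ]
  rw [hgoal]
  generalize ∑ i, κ i = K at hbound hzero
  have hK := abs_lt.1 (show |K| < 2 by omega)
  obtain rfl | rfl | rfl : K = -1 ∨ K = 0 ∨ K = 1 := by omega
  · rw [if_neg (by rintro rfl; simp at hbound)]
    decide
  · rw [if_pos (hzero rfl)]
    rfl
  · rw [if_neg (by rintro rfl; simp at hbound)]
    decide

end CircularTriangleFree

end

theorem theorem1 {V : Type*} [Countable V] (G : SimpleGraph V) (hG : G.CliqueFree 3) :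
    Nonempty (G ↪g CircularTriangleFree.genericGraph) ↔
      CircularTriangleFree.AntiEvenSignable Gᶜ := by
  classical
  have hG' (a b c : V) (hab : G.Adj a b) (hbc : G.Adj b c) : ¬ G.Adj a c := fun hac =>
    hG {a, b, c} (is3Clique_triple_iff.2 ⟨hab, hac, hbc⟩)
  constructor
  · rintro ⟨f⟩
    refine CircularTriangleFree.antiEvenSignable_of_angles (θ := fun v => (f v).1.arg) hG'
      (fun v => (f v).2.2) (fun v => (f v).1.arg_mem_Ioc) fun u v => ?_
    rw [← f.map_adj_iff, CircularTriangleFree.genericGraph_adj_iff]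
  · intro h
    obtain ⟨c, hc⟩ := CircularTriangleFree.exists_isCircularColouring hG' h
    obtain ⟨_, hlt⟩ := hc.exists_linearOrder hG'
    obtain ⟨θ, hinj, hq, hθ, hadj⟩ := CircularTriangleFree.exists_rational_angles hlt
    exact CircularTriangleFree.nonempty_embedding_of_angles hinj hq hθ hadj
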